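/- Setting. Let $X$ be a separable reflexive Banach space and $Y$ a Banach space over the same field $\mathbb R$ or $\mathbb C$; for a normed space $Z$, $Z^\ast$ denotes its space of bounded linear functionals with the operator norm. Let $\mathcal L$ be a family of bounded linear operators $L\colon X\to Y$, equipped with a $\sigma$-compact, locally compact, Hausdorff, separable topology such that $\mathcal L\ni L\mapsto Lx\in Y$ is continuous for every fixed $x\in X$. Put $$E=\Big\{x\in X:\ \sup_{L\in\mathcal L}\|Lx\|_Y<\infty\Big\},\qquad \|x\|_E=\sup_{L\in\mathcal L}\|Lx\|_Y,\qquad E_0=\Big\{x\in E:\ \limsup_{\mathcal L\ni L\to\infty}\|Lx\|_Y=0\Big\},$$ where $L\to\infty$ means that $L$ escapes all compact subsets of $\mathcal L$, and $E_0$ carries the norm of $E$. Assume that $\|\cdot\|_E$ is a norm under which $E$ is a Banach space, and that $E$ is continuously contained and dense in $X$. Assume the approximation property (AP): for every $x\in E$ there is a sequence $(x_n)\subset E_0$ such that $\|x_n\|_E\le\|x\|_E$ for all $n$ and $x_n\to x$ in $X$. Let $(L_n)_{n\ge1}$ be any dense sequence in $\mathcal L$, and let $$E_\ast=\ell^1(Y^\ast)/P,\qquad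 P=\Big\{(y_n^\ast)\in\ell^1(Y^\ast):\ \sum_{n=1}^\infty y_n^\ast(L_nx)=0\ \text{ for all } x\in E\Big\},$$ with the quotient norm. **Theorem 3.2.** Under these assumptions: 1. $E_\ast^\ast=E$ isometrically: there is a linear isometric isomorphism $J$ of $E$ onto $E_\ast^\ast$ with $Jx\big((y_n^\ast)+P\big)=\sum_{n=1}^\infty y_n^\ast(L_nx)$ for all $x\in E$ and $(y_n^\ast)\in\ell^1(Y^\ast)$. 2. $X^\ast$ is continuously and densely contained in $E_\ast$ via the $X$-$X^\ast$-pairing: there is an injective bounded linear map $j\colon X^\ast\to E_\ast$ with dense range such that $Jx(jx^\ast)=x^\ast(x)$ for all $x^\ast\in X^\ast$ and $x\in E$. 3. With $X^\ast$ regarded as a subspace of $E_\ast$ through $j$, the identity map on $X^\ast$ extends to an isometric isomorphism of $E_\ast$ onto $E_0^\ast$: there is a unique linear isometric isomorphism $K$ of $E_\ast$ onto $E_0^\ast$ such that $(K(jx^\ast))(x)=x^\ast(x)$ for all $x^\ast\in X^\ast$ and $x\in E_0$. In this sense $E_0^\ast=E_\ast$ and $E_\ast^\ast=E$, isometrically via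 the $X$-$X^\ast$-pairing. -/

import Mathlib

open Filter Topology Set

noncomputable section

namespace Bidual

variable {𝕜 X Y Λ : Type*} [RCLike 𝕜]
  [NormedAddCommGroup X] [NormedSpace 𝕜 X] [NormedAddCommGroup Y] [NormedSpace 𝕜 Y]

/-- The vectors of `X` on which the family of operators `L` is bounded. -/
def boundedVectors (L : Λ → X →L[𝕜] Y) : Submodule 𝕜 X where
  carrier := {x | BddAbove (range fun l => ‖L l x‖)}
  zero_mem' := ⟨0, by rintro _ ⟨l, rfl⟩; simp⟩
  add_mem' := by
    rintro x y ⟨a, ha⟩ ⟨b, hb⟩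
    refine ⟨a + b, ?_⟩
    rintro _ ⟨l, rfl⟩
    simp only [map_add]
    exact (norm_add_le _ _).trans (add_le_add (ha ⟨l, rfl⟩) (hb ⟨l, rfl⟩))
  smul_mem' := by
    rintro c x ⟨a, ha⟩
    refine ⟨‖c‖ * a, ?_⟩
    rintro _ ⟨l, rfl⟩
    simp only [map_smul, norm_smul]
    exact mul_le_mul_of_nonneg_left (ha ⟨l, rfl⟩) (norm_nonneg _)

/-- The space `E = {x ∈ X : sup_L ‖L x‖ < ∞}`. It is a type of its own, because it carries the norm
`sup_L ‖L x‖` and not the norm of `X`. -/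
def E (L : Λ → X →L[𝕜] Y) : Type _ := ↥(boundedVectors L)

instance (L : Λ → X →L[𝕜] Y) : AddCommGroup (E L) :=
  inferInstanceAs (AddCommGroup ↥(boundedVectors L))

instance (L : Λ → X →L[𝕜] Y) : Module 𝕜 (E L) :=
  inferInstanceAs (Module 𝕜 ↥(boundedVectors L))

/-- The inclusion of `E` in `X`. -/
def E.incl (L : Λ → X →L[𝕜] Y) : E L →ₗ[𝕜] X := (boundedVectors L).subtype

lemma E.bddAbove {L : Λ → X →L[𝕜] Y} (x : E L) :
    BddAbove (range fun l => ‖L l (E.incl L x)‖) := x.2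

/-- The norm `‖x‖_E = sup_L ‖L x‖`; a priori only a seminorm. -/
def E.addGroupSeminorm (L : Λ → X →L[𝕜] Y) : AddGroupSeminorm (E L) where
  toFun x := ⨆ l, ‖L l (E.incl L x)‖
  map_zero' := by simp
  add_le' x y := by
    refine Real.iSup_le (fun l => ?_)
      (add_nonneg (Real.iSup_nonneg fun _ => norm_nonneg _)
        (Real.iSup_nonneg fun _ => norm_nonneg _))
    simp only [map_add]
    exact (norm_add_le _ _).trans (add_le_add (le_ciSup x.bddAbove l) (le_ciSup y.bddAbove l))
  neg' x := by simp

instance (L : Λ → X →L[𝕜] Y) : SeminormedAddCommGroup (E L) :=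
  (E.addGroupSeminorm L).toSeminormedAddCommGroup

lemma E.norm_def {L : Λ → X →L[𝕜] Y} (x : E L) : ‖x‖ = ⨆ l, ‖L l (E.incl L x)‖ := rfl

lemma E.norm_apply_le {L : Λ → X →L[𝕜] Y} (x : E L) (l : Λ) : ‖L l (E.incl L x)‖ ≤ ‖x‖ :=
  le_ciSup x.bddAbove l

instance (L : Λ → X →L[𝕜] Y) : NormedSpace 𝕜 (E L) where
  norm_smul_le c x := by
    rw [E.norm_def]
    refine Real.iSup_le (fun l => ?_) (by positivity)
    simp only [map_smul, norm_smul]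
    exact mul_le_mul_of_nonneg_left (x.norm_apply_le l) (norm_nonneg _)

/-- The vanishing subspace `E₀` of those `x ∈ E` with `‖L x‖ → 0` as `L` escapes all compact sets,
that is, along the filter `cocompact Λ`. It carries the norm of `E`. -/
def E0 [TopologicalSpace Λ] (L : Λ → X →L[𝕜] Y) : Submodule 𝕜 (E L) where
  carrier := {x | Tendsto (fun l => ‖L l (E.incl L x)‖) (cocompact Λ) (𝓝 0)}
  zero_mem' := by simpa using tendsto_const_nhds
  add_mem' := by
    intro x y hx hy
    simp only [mem_ofPred_eq, ← tendsto_zero_iff_norm_tendsto_zero] at hx hy ⊢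
    simpa using hx.add hy
  smul_mem' := by
    intro c x hx
    simp only [mem_ofPred_eq, ← tendsto_zero_iff_norm_tendsto_zero] at hx ⊢
    simpa using hx.const_smul c

/-- `E₀` is described by `limsup_{L → ∞} ‖L x‖ = 0`. -/
lemma mem_E0_iff_limsup [TopologicalSpace Λ] (L : Λ → X →L[𝕜] Y) (x : E L) :
    x ∈ E0 L ↔ limsup (fun l => ‖L l (E.incl L x)‖ₑ) (cocompact Λ) = 0 := by
  change Tendsto (fun l => ‖L l (E.incl L x)‖) (cocompact Λ) (𝓝 0) ↔ _
  rw [← tendsto_zero_iff_norm_tendsto_zero, tendsto_zero_iff_enorm_tendsto_zero]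
  constructor
  · intro h
    rcases (cocompact Λ).eq_or_neBot with hb | hb
    · simp [hb]
    · exact h.limsup_eq
  · intro h
    exact tendsto_of_le_liminf_of_limsup_le (by simp) h.le

/-- The approximation property (AP): every `x ∈ E` is the limit in `X` of a sequence in `E₀` whose
terms have `E`-norm at most `‖x‖_E`. -/
def ApproximationProperty [TopologicalSpace Λ] (L : Λ → X →L[𝕜] Y) : Prop :=
  ∀ x : E L, ∃ u : ℕ → E L, (∀ n, u n ∈ E0 L) ∧ (∀ n, ‖u n‖ ≤ ‖x‖) ∧
    Tendsto (fun n => E.incl L (u n)) atTop (𝓝 (E.incl L x))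

/-- The space `ℓ¹(Y*)`. -/
abbrev ellOneDual (𝕜 Y : Type*) [RCLike 𝕜] [NormedAddCommGroup Y] [NormedSpace 𝕜 Y] : Type _ :=
  lp (fun _ : ℕ => StrongDual 𝕜 Y) 1

lemma ellOneDual.summable_norm (y : ellOneDual 𝕜 Y) : Summable fun n => ‖y n‖ := by
  have h := lp.memℓp y
  rw [memℓp_gen_iff (by simp)] at h
  simpa using h

lemma ellOneDual.summable_pairing {L : Λ → X →L[𝕜] Y} (s : ℕ → Λ) (x : E L)
    (y : ellOneDual 𝕜 Y) : Summable fun n => y n (L (s n) (E.incl L x)) := by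
  refine Summable.of_norm_bounded ((ellOneDual.summable_norm y).mul_right ‖x‖) fun n => ?_
  exact ((y n).le_opNorm _).trans
    (mul_le_mul_of_nonneg_left (x.norm_apply_le (s n)) (norm_nonneg _))

/-- The linear functional `(yₙ) ↦ ∑ₙ yₙ(Lₙ x)` on `ℓ¹(Y*)` given by `x ∈ E`, where
`Lₙ = L (s n)`. -/
def pairing (L : Λ → X →L[𝕜] Y) (s : ℕ → Λ) (x : E L) : ellOneDual 𝕜 Y →ₗ[𝕜] 𝕜 where
  toFun y := ∑' n, y n (L (s n) (E.incl L x))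
  map_add' y z := by
    simpa using (ellOneDual.summable_pairing s x y).tsum_add (ellOneDual.summable_pairing s x z)
  map_smul' c y := by
    simpa using (ellOneDual.summable_pairing s x y).tsum_mul_left c

/-- The subspace `P` of `ℓ¹(Y*)` of the sequences that annihilate `E`. -/
def P (L : Λ → X →L[𝕜] Y) (s : ℕ → Λ) : Submodule 𝕜 (ellOneDual 𝕜 Y) :=
  ⨅ x : E L, LinearMap.ker (pairing L s x)

/-- The space `E_* = ℓ¹(Y*) / P` with the quotient norm, where `P` is taken with respect to the
sequence of operators `Lₙ = L (s n)`. -/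
abbrev EStar (L : Λ → X →L[𝕜] Y) (s : ℕ → Λ) : Type _ := ellOneDual 𝕜 Y ⧸ P L s

end Bidual

end

/-! Everything passes through the closure Z in E* of the functionals that extend boundedly to X
(`Predual`). Three facts carry the theorem. Z* = E: a functional on Z pulls back to X*, so
reflexivity represents it by some x in X; testing on y* ∘ L, whose norm in E* is at most ‖y*‖,
bounds every ‖L x‖ and puts x in E (`exists_eval_eq`). E_* = Z: the map (yₙ*) ↦ ∑ yₙ* ∘ Lₙ into Z
has kernel P, and by density of (Lₙ) its adjoint does not decrease norms. It is therefore a metric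
surjection (`exists_preimage_of_norm_le_norm_comp`). Z = E₀*: restriction to E₀ is isometric by
(AP). For dense range, embed E₀ in C₀(Λ, Y) and extend a functional by Hahn–Banach. The extension is
nearly concentrated on a compact set (`exists_cutoff_norm_sub_le`), and its cutoff is bounded on X
by Banach–Steinhaus. No representation of C₀(Λ, Y)* by vector measures is needed. -/

namespace Bidual

/-! ### Metric surjections via Hahn–Banach and successive approximation. -/

section MetricSurjection

variable {𝕜 G W : Type*} [RCLike 𝕜] [NormedAddCommGroup G] [NormedSpace 𝕜 G]
  [NormedAddCommGroup W] [NormedSpace 𝕜 W]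

/-- If the adjoint of `T` does not decrease norms, then the image of every closed ball is dense in
the closed ball of the same radius. -/
lemma exists_approx_preimage_of_norm_le_norm_comp (T : G →L[𝕜] W)
    (hT : ∀ ψ : StrongDual 𝕜 W, ‖ψ‖ ≤ ‖ψ.comp T‖) (w : W) {δ : ℝ} (hδ : 0 < δ) :
    ∃ y : G, ‖y‖ ≤ ‖w‖ ∧ ‖w - T y‖ < δ := by
  let : NormedSpace ℝ W := NormedSpace.restrictScalars ℝ 𝕜 W
  let : NormedSpace ℝ G := NormedSpace.restrictScalars ℝ 𝕜 G
  have : IsScalarTower ℝ 𝕜 W := RestrictScalars.isScalarTower ℝ 𝕜 W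
  have : IsScalarTower ℝ 𝕜 G := RestrictScalars.isScalarTower ℝ 𝕜 G
  rcases eq_or_ne w 0 with rfl | hw
  · exact ⟨0, by simp, by simpa using hδ⟩
  have hwpos : 0 < ‖w‖ := norm_pos_iff.2 hw
  -- Otherwise a functional ψ separates w from the image of the ball, giving ‖ψ ∘ T‖ ‖w‖ ≤ u < Re
  -- ψ(w) ≤ ‖ψ‖ ‖w‖, against `hT`.
  have hmem : w ∈ closure (T '' Metric.closedBall 0 ‖w‖) := by
    by_contra hnot
    have hconv : Convex ℝ (closure (T '' Metric.closedBall (0 : G) ‖w‖)) :=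
      ((convex_closedBall (0 : G) ‖w‖).linear_image (T.restrictScalars ℝ).toLinearMap).closure
    obtain ⟨ψ, u, hu, huw⟩ := RCLike.geometric_hahn_banach_closed_point (𝕜 := 𝕜) hconv
      isClosed_closure hnot
    have hball : ∀ y ∈ Metric.closedBall (0 : G) ‖w‖, ‖(ψ.comp T).toLinearMap y‖ ≤ u := by
      intro y hy
      -- The ball is invariant under unimodular scalars, so a bound on real parts is a bound on
      -- moduli.
      obtain ⟨c, hc, hcy⟩ := RCLike.exists_norm_eq_mul_self (ψ (T y))
      have h := hu (T (c • y)) (subset_closure ⟨c • y, by simpa [norm_smul, hc] using hy, rfl⟩)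
      rw [map_smul, map_smul, smul_eq_mul, ← hcy, RCLike.ofReal_re] at h
      exact h.le
    have hu0 : 0 ≤ u := (norm_nonneg _).trans (hball 0 (by simp))
    have hcomp : ‖ψ.comp T‖ ≤ u / ‖w‖ :=
      ContinuousLinearMap.opNorm_le_bound _ (by positivity) fun y =>
        LinearMap.bound_of_ball_bound' hwpos u (ψ.comp T).toLinearMap hball y
    have h1 : ‖ψ‖ * ‖w‖ ≤ u := (le_div_iff₀ hwpos).1 ((hT ψ).trans hcomp)
    exact absurd (huw.trans_le ((RCLike.re_le_norm _).trans (ψ.le_opNorm w))) h1.not_gt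
  obtain ⟨_, ⟨y, hy, rfl⟩, hd⟩ := Metric.mem_closure_iff.1 hmem δ hδ
  exact ⟨y, by simpa using hy, by rwa [dist_eq_norm] at hd⟩

/-- A bounded operator out of a Banach space whose adjoint does not decrease norms is a metric
surjection. -/
lemma exists_preimage_of_norm_le_norm_comp [CompleteSpace G] (T : G →L[𝕜] W)
    (hT : ∀ ψ : StrongDual 𝕜 W, ‖ψ‖ ≤ ‖ψ.comp T‖) (w : W) {ε : ℝ} (hε : 0 < ε) :
    ∃ y : G, T y = w ∧ ‖y‖ ≤ ‖w‖ + ε := by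
  choose! g hg using fun (w : W) (δ : ℝ) (hδ : 0 < δ) =>
    exists_approx_preimage_of_norm_le_norm_comp T hT w hδ
  -- `r n` is the residual after n corrections. The first correction costs at most ‖w‖; the later
  -- ones cost at most ∑ δ n = ε.
  set δ : ℕ → ℝ := fun n => ε / 2 / 2 ^ n with hδdef
  have hδ : ∀ n, 0 < δ n := fun n => by positivity
  let r : ℕ → W := fun n => Nat.rec w (fun n v => v - T (g v (δ n))) n
  have hr : ∀ n, r (n + 1) = r n - T (g (r n) (δ n)) := fun n => rfl
  have hrn : ∀ n, ‖r (n + 1)‖ ≤ δ n := fun n => (hg (r n) (δ n) (hδ n)).2.le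
  let y : ℕ → G := fun n => g (r n) (δ n)
  have hy : ∀ n, ‖y n‖ ≤ ‖r n‖ := fun n => (hg (r n) (δ n) (hδ n)).1
  have hδsum : HasSum δ ε := hasSum_geometric_two' ε
  have hy1 : ∀ n, ‖y (n + 1)‖ ≤ δ n := fun n => (hy (n + 1)).trans (hrn n)
  have hsum1 : Summable fun n => ‖y (n + 1)‖ :=
    Summable.of_nonneg_of_le (fun _ => norm_nonneg _) hy1 hδsum.summable
  have hsum : Summable fun n => ‖y n‖ := (summable_nat_add_iff 1).1 hsum1
  refine ⟨∑' n, y n, ?_, ?_⟩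
  · have hpart : ∀ n, ∑ i ∈ Finset.range n, T (y i) = w - r n := by
      intro n
      induction n with
      | zero => simp [r]
      | succ n ih => rw [Finset.sum_range_succ, ih, hr]; simp only [y]; abel
    have h0 : Tendsto r atTop (𝓝 0) := by
      rw [← tendsto_add_atTop_iff_nat 1]
      exact squeeze_zero_norm hrn hδsum.summable.tendsto_atTop_zero
    have h1 := (hsum.of_norm.hasSum.mapL T).tendsto_sum_nat
    simp only [hpart] at h1
    simpa using tendsto_nhds_unique h1 (h0.const_sub w)
  · calc ‖∑' n, y n‖ ≤ ∑' n, ‖y n‖ := norm_tsum_le_tsum_norm hsum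
      _ = ‖y 0‖ + ∑' n, ‖y (n + 1)‖ := hsum.tsum_eq_zero_add
      _ ≤ ‖w‖ + ε := add_le_add (hy 0) ((hsum1.tsum_le_tsum hy1 hδsum.summable).trans_eq
          hδsum.tsum_eq)

end MetricSurjection

/-! ### Compact concentration of functionals on C₀(Λ, Y). -/

section Cutoff

open scoped ZeroAtInfty

variable {𝕜 Y Λ : Type*} [RCLike 𝕜] [NormedAddCommGroup Y] [NormedSpace 𝕜 Y] [TopologicalSpace Λ]

lemma zeroAtInfty_norm_le {f : C₀(Λ, Y)} {C : ℝ} (hC : 0 ≤ C) : ‖f‖ ≤ C ↔ ∀ l, ‖f l‖ ≤ C := by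
  rw [← ZeroAtInftyContinuousMap.norm_toBCF_eq_norm, BoundedContinuousFunction.norm_le hC]
  rfl

lemma zeroAtInfty_norm_apply_le (f : C₀(Λ, Y)) (l : Λ) : ‖f l‖ ≤ ‖f‖ :=
  (zeroAtInfty_norm_le (norm_nonneg f)).1 le_rfl l

/-- Multiplication of continuous functions by a compactly supported function. -/
noncomputable def cutoff (𝕜 : Type*) [RCLike 𝕜] [NormedSpace 𝕜 Y] (χ : C(Λ, ℝ))
    (hχ : HasCompactSupport χ) : C(Λ, Y) →ₗ[𝕜] C₀(Λ, Y) where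
  toFun F :=
    { toFun := fun l => (χ l : 𝕜) • F l
      continuous_toFun := by fun_prop
      zero_at_infty' := by
        refine HasCompactSupport.is_zero_at_infty (HasCompactSupport.smul_right ?_)
        exact hχ.comp_left (g := fun r : ℝ => (r : 𝕜)) (by simp) }
  map_add' F H := by ext l; exact smul_add _ _ _
  map_smul' c F := by ext l; exact smul_comm _ _ _

/-- Every bounded functional on `C₀(Λ, Y)` is almost concentrated on a compact set. -/
lemma exists_cutoff_norm_sub_le [T2Space Λ] [LocallyCompactSpace Λ]
    (φ : StrongDual 𝕜 C₀(Λ, Y)) {ε : ℝ} (hε : 0 < ε) :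
    ∃ (χ : C(Λ, ℝ)) (hχ : HasCompactSupport χ), (∀ l, χ l ∈ Icc (0 : ℝ) 1) ∧
      ∀ h : C₀(Λ, Y), ‖φ h - φ (cutoff 𝕜 χ hχ (h : C(Λ, Y)))‖ ≤ ε * ‖h‖ := by
  -- The final estimate is ‖φ‖ - δ + ‖φ q‖ ≤ ‖φ‖ (1 + δ), that is, ‖φ q‖ ≤ ‖φ‖ δ + δ.
  obtain ⟨δ, hδ, hδε⟩ : ∃ δ : ℝ, 0 < δ ∧ ‖φ‖ * δ + δ ≤ ε :=
    ⟨ε / (‖φ‖ + 1), by positivity, by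
      rw [← add_one_mul, mul_div_cancel₀]; positivity⟩
  obtain ⟨g₀, hg₀, hg₀φ⟩ := φ.exists_lt_apply_of_lt_opNorm (show ‖φ‖ - δ < ‖φ‖ by linarith)
  obtain ⟨a, ha, hag⟩ := RCLike.exists_norm_eq_mul_self (φ g₀)
  set g := a • g₀ with hgdef
  have hg : ‖g‖ ≤ 1 := by rw [hgdef, norm_smul, ha, one_mul]; exact hg₀.le
  have hφg : φ g = (‖φ g₀‖ : 𝕜) := by rw [hgdef, map_smul, smul_eq_mul, hag]
  have hev : ∀ᶠ l in cocompact Λ, ‖g l‖ < δ := by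
    have := (zero_at_infty g).norm
    rw [norm_zero] at this
    exact this.eventually (gt_mem_nhds hδ)
  obtain ⟨k, hk, hkg⟩ := mem_cocompact.1 hev
  obtain ⟨χ, hχ1, -, hχ, hχI⟩ := exists_continuous_one_zero_of_isCompact hk isClosed_empty
    (disjoint_empty k)
  refine ⟨χ, hχ, hχI, fun h => ?_⟩
  let D : C₀(Λ, Y) →ₗ[𝕜] 𝕜 :=
    { toFun := fun h => φ h - φ (cutoff 𝕜 χ hχ (h : C(Λ, Y)))
      map_add' := fun p q => by
        have : ((p + q : C₀(Λ, Y)) : C(Λ, Y)) = (p : C(Λ, Y)) + (q : C(Λ, Y)) := rfl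
        rw [this, map_add, map_add, map_add]; ring
      map_smul' := fun c p => by
        have : ((c • p : C₀(Λ, Y)) : C(Λ, Y)) = c • (p : C(Λ, Y)) := rfl
        rw [this, map_smul, map_smul, map_smul, RingHom.id_apply, smul_sub] }
  have hD : ∀ p ∈ Metric.closedBall (0 : C₀(Λ, Y)) 1, ‖D p‖ ≤ ε := by
    intro p hp
    have hp1 : ‖p‖ ≤ 1 := by simpa using hp
    set q : C₀(Λ, Y) := p - cutoff 𝕜 χ hχ (p : C(Λ, Y)) with hq
    have hDq : D p = φ q := (map_sub φ _ _).symm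
    obtain ⟨c, hc, hcq⟩ := RCLike.exists_norm_eq_mul_self (φ q)
    have hql : ∀ l, q l = ((1 - χ l : ℝ) : 𝕜) • p l := by
      intro l
      change p l - (χ l : 𝕜) • p l = _
      push_cast
      rw [sub_smul, one_smul]
    -- q vanishes on k and g is below δ off k, so the sup norms hardly add, whereas the values of φ
    -- do. As g almost attains ‖φ‖, little is left for φ q.
    have hnorm : ‖g + c • q‖ ≤ 1 + δ := by
      refine (zeroAtInfty_norm_le (by positivity)).2 fun l => ?_
      have hgl := zeroAtInfty_norm_apply_le g l
      have hpl := zeroAtInfty_norm_apply_le p l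
      change ‖g l + c • q l‖ ≤ _
      by_cases hl : l ∈ k
      · have : χ l = 1 := hχ1 hl
        rw [hql, this]
        simp only [sub_self, RCLike.ofReal_zero, zero_smul, smul_zero, add_zero]
        linarith
      · have h1 : ‖g l‖ < δ := hkg hl
        have h2 : ‖c • q l‖ ≤ 1 := by
          rw [norm_smul, hc, one_mul, hql, norm_smul, RCLike.norm_ofReal,
            abs_of_nonneg (by linarith [(hχI l).2])]
          exact mul_le_one₀ (by linarith [(hχI l).1]) (norm_nonneg _) (hpl.trans hp1)
        exact (norm_add_le _ _).trans (by linarith)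
    have hφ : φ (g + c • q) = ((‖φ g₀‖ + ‖φ q‖ : ℝ) : 𝕜) := by
      rw [map_add, hφg, map_smul, smul_eq_mul, ← hcq]; push_cast; rfl
    have hle := φ.le_of_opNorm_le_of_le le_rfl hnorm
    rw [hφ, RCLike.norm_ofReal, abs_of_nonneg (by positivity)] at hle
    rw [hDq]
    linarith
  simpa [D] using LinearMap.bound_of_ball_bound' one_pos ε D hD h

end Cutoff

end Bidual

noncomputable section

namespace Bidual

variable {𝕜 X Y Λ : Type*} [RCLike 𝕜]
  [NormedAddCommGroup X] [NormedSpace 𝕜 X] [NormedAddCommGroup Y] [NormedSpace 𝕜 Y]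

/-! ### Dual spaces of seminormed spaces. -/

/-- The isometry of dual spaces induced by an isometry. -/
def dualCongr {F G : Type*} [SeminormedAddCommGroup F] [NormedSpace 𝕜 F]
    [SeminormedAddCommGroup G] [NormedSpace 𝕜 G] (e : F ≃ₗᵢ[𝕜] G) :
    StrongDual 𝕜 G ≃ₗᵢ[𝕜] StrongDual 𝕜 F where
  toFun ψ := ψ.comp e.toContinuousLinearEquiv.toContinuousLinearMap
  invFun φ := φ.comp e.symm.toContinuousLinearEquiv.toContinuousLinearMap
  map_add' _ _ := rfl
  map_smul' _ _ := rfl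
  left_inv ψ := ContinuousLinearMap.ext fun x => congrArg ψ (e.apply_symm_apply x)
  right_inv φ := ContinuousLinearMap.ext fun x => congrArg φ (e.symm_apply_apply x)
  norm_map' ψ := by
    refine le_antisymm (ContinuousLinearMap.opNorm_le_bound _ (norm_nonneg ψ) fun x => ?_)
      (ContinuousLinearMap.opNorm_le_bound _ (norm_nonneg _) fun y => ?_)
    · exact (ψ.le_opNorm (e x)).trans_eq (by rw [e.norm_map])
    · have h := (ψ.comp e.toContinuousLinearEquiv.toContinuousLinearMap).le_opNorm (e.symm y)
      rw [e.symm.norm_map] at h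
      exact (congrArg (fun z => ‖ψ z‖) (e.apply_symm_apply y)).symm.trans_le h

lemma dualCongr_apply {F G : Type*} [SeminormedAddCommGroup F] [NormedSpace 𝕜 F]
    [SeminormedAddCommGroup G] [NormedSpace 𝕜 G] (e : F ≃ₗᵢ[𝕜] G) (ψ : StrongDual 𝕜 G) (x : F) :
    dualCongr e ψ x = ψ (e x) := rfl

/-- The dual of a seminormed space is a normed space. -/
instance dualNormedAddCommGroup {F : Type*} [SeminormedAddCommGroup F] [NormedSpace 𝕜 F] :
    NormedAddCommGroup (StrongDual 𝕜 F) :=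
  NormedAddCommGroup.ofSeparation fun f hf => ContinuousLinearMap.ext fun x =>
    norm_le_zero_iff.1 (by simpa [hf] using f.le_opNorm x)

/-! ### The predual of E as a closure of X* in E*. -/

/-- The inclusion of `E` in `X` as a bounded operator. -/
def inclCLM (L : Λ → X →L[𝕜] Y) (hcont : Continuous (E.incl L)) : E L →L[𝕜] X :=
  ⟨E.incl L, hcont⟩

/-- Restriction of functionals from `X` to `E`. -/
def restrictDual (L : Λ → X →L[𝕜] Y) (hcont : Continuous (E.incl L)) :
    StrongDual 𝕜 X →L[𝕜] StrongDual 𝕜 (E L) :=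
  (ContinuousLinearMap.compL 𝕜 (E L) X 𝕜).flip (inclCLM L hcont)

/-- The closure in `E*` of the functionals that are bounded on `X`. -/
def predualSubmodule (L : Λ → X →L[𝕜] Y) (hcont : Continuous (E.incl L)) :
    Submodule 𝕜 (StrongDual 𝕜 (E L)) :=
  (LinearMap.range (restrictDual L hcont).toLinearMap).topologicalClosure

/-- The predual of `E`: the closure in `E*` of the functionals that are bounded on `X`. -/
def Predual (L : Λ → X →L[𝕜] Y) (hcont : Continuous (E.incl L)) : Type _ :=
  ↥(predualSubmodule L hcont)

section Predual

variable {L : Λ → X →L[𝕜] Y} {hcont : Continuous (E.incl L)}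

instance : NormedAddCommGroup (Predual L hcont) :=
  inferInstanceAs (NormedAddCommGroup ↥(predualSubmodule L hcont))

instance : NormedSpace 𝕜 (Predual L hcont) :=
  inferInstanceAs (NormedSpace 𝕜 ↥(predualSubmodule L hcont))

instance : CompleteSpace (Predual L hcont) :=
  (Submodule.isClosed_topologicalClosure
    (LinearMap.range (restrictDual L hcont).toLinearMap)).completeSpace_coe

/-- The inclusion of the predual of `E` in the dual of `E`. -/
def Predual.incl (L : Λ → X →L[𝕜] Y) (hcont : Continuous (E.incl L)) :
    Predual L hcont →ₗᵢ[𝕜] StrongDual 𝕜 (E L) :=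
  (predualSubmodule L hcont).subtypeₗᵢ

lemma restrictDual_mem (f : StrongDual 𝕜 X) :
    restrictDual L hcont f ∈ predualSubmodule L hcont :=
  Submodule.le_topologicalClosure _ ⟨f, rfl⟩

/-- The map of `X*` into the predual of `E`. -/
def toPredual (L : Λ → X →L[𝕜] Y) (hcont : Continuous (E.incl L)) :
    StrongDual 𝕜 X →L[𝕜] Predual L hcont :=
  (restrictDual L hcont).codRestrict (predualSubmodule L hcont) restrictDual_mem

lemma denseRange_toPredual : DenseRange (toPredual L hcont) := by
  intro w
  rw [Metric.mem_closure_iff]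
  intro ε hε
  obtain ⟨_, ⟨f, rfl⟩, hd⟩ := Metric.mem_closure_iff.1 w.2 ε hε
  exact ⟨_, ⟨f, rfl⟩, hd⟩

lemma injective_toPredual (hdense : DenseRange (E.incl L)) :
    Function.Injective (toPredual L hcont) := by
  intro f g h
  refine ContinuousLinearMap.coeFn_injective (hdense.equalizer f.continuous g.continuous ?_)
  funext x
  exact congrArg (fun w => Predual.incl L hcont w x) h

/-- The norm is taken in E*, where each L has norm at most 1; the bound is thus uniform in `l`, as
it need not be in X*. -/
lemma norm_functional_comp_le (f : StrongDual 𝕜 Y) (l : Λ) :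
    ‖restrictDual L hcont (f.comp (L l))‖ ≤ ‖f‖ :=
  ContinuousLinearMap.opNorm_le_bound _ (norm_nonneg _) fun x =>
    (f.le_opNorm _).trans (mul_le_mul_of_nonneg_left (x.norm_apply_le l) (norm_nonneg _))

/-- Every functional on the predual of `E` is the evaluation at a vector of `E`. -/
lemma exists_eval_eq (hrefl : Function.Surjective (NormedSpace.inclusionInDoubleDual 𝕜 X))
    (ψ : StrongDual 𝕜 (Predual L hcont)) :
    ∃ x : E L, ‖x‖ ≤ ‖ψ‖ ∧ ∀ w : Predual L hcont, ψ w = Predual.incl L hcont w x := by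
  obtain ⟨x, hx⟩ := hrefl (ψ.comp (toPredual L hcont))
  have hx' : ∀ f : StrongDual 𝕜 X, f x = ψ (toPredual L hcont f) := fun f =>
    DFunLike.congr_fun hx f
  have hLx : ∀ l, ‖L l x‖ ≤ ‖ψ‖ := fun l =>
    NormedSpace.norm_le_dual_bound 𝕜 _ (norm_nonneg _) fun f => by
      rw [← ContinuousLinearMap.comp_apply, hx']
      exact (ψ.le_opNorm _).trans
        (mul_le_mul_of_nonneg_left (norm_functional_comp_le f l) (norm_nonneg _))
  let e : E L := ⟨x, ‖ψ‖, by rintro _ ⟨l, rfl⟩; exact hLx l⟩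
  refine ⟨e, Real.iSup_le hLx (norm_nonneg _), ?_⟩
  have hcont_eval : Continuous fun w => Predual.incl L hcont w e :=
    (ContinuousLinearMap.apply 𝕜 𝕜 e).continuous.comp (Predual.incl L hcont).continuous
  exact congrFun (denseRange_toPredual.equalizer ψ.continuous hcont_eval
    (funext fun f => (hx' f).symm))

/-- Evaluation of the predual of `E` at vectors of `E`. -/
def evalPredual (L : Λ → X →L[𝕜] Y) (hcont : Continuous (E.incl L)) :
    E L →L[𝕜] StrongDual 𝕜 (Predual L hcont) :=
  (ContinuousLinearMap.compL 𝕜 (Predual L hcont) (StrongDual 𝕜 (E L)) 𝕜).flip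
    (Predual.incl L hcont).toContinuousLinearMap ∘L NormedSpace.inclusionInDoubleDual 𝕜 (E L)

lemma evalPredual_apply (x : E L) (w : Predual L hcont) :
    evalPredual L hcont x w = Predual.incl L hcont w x := rfl

lemma injective_evalPredual : Function.Injective (evalPredual L hcont) := by
  intro x y h
  refine Subtype.val_injective (p := fun v => v ∈ boundedVectors L)
    (SeparatingDual.eq_iff_forall_dual_eq (R := 𝕜) |>.2 fun f => ?_)
  exact DFunLike.congr_fun h (toPredual L hcont f)

/-- The dual of the predual of `E` is `E`. -/
def evalPredualEquiv (hcont : Continuous (E.incl L))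
    (hrefl : Function.Surjective (NormedSpace.inclusionInDoubleDual 𝕜 X)) :
    E L ≃ₗᵢ[𝕜] StrongDual 𝕜 (Predual L hcont) where
  toLinearEquiv := LinearEquiv.ofBijective (evalPredual L hcont).toLinearMap
    ⟨injective_evalPredual, fun ψ => by
      obtain ⟨x, -, hx⟩ := exists_eval_eq hrefl ψ
      exact ⟨x, ContinuousLinearMap.ext fun w => (hx w).symm⟩⟩
  norm_map' x := by
    change ‖evalPredual L hcont x‖ = ‖x‖
    refine le_antisymm (ContinuousLinearMap.opNorm_le_bound _ (norm_nonneg _) fun w => ?_) ?_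
    · rw [evalPredual_apply, mul_comm]
      exact (Predual.incl L hcont w).le_opNorm x
    -- The representing vector with the norm bound must be x itself, since evaluation is injective.
    · obtain ⟨y, hy, hxy⟩ := exists_eval_eq hrefl (evalPredual L hcont x)
      have : x = y := injective_evalPredual (ContinuousLinearMap.ext hxy)
      exact (congrArg norm this).trans_le hy

lemma evalPredualEquiv_apply
    (hrefl : Function.Surjective (NormedSpace.inclusionInDoubleDual 𝕜 X)) (x : E L)
    (w : Predual L hcont) :
    evalPredualEquiv hcont hrefl x w = Predual.incl L hcont w x := rfl

/-- Convergence in X handles functionals from X*; boundedness in E extends it to their norm limits.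
This is how (AP) acts on the predual. -/
lemma tendsto_predual_apply {u : ℕ → E L} {x : E L} {C : ℝ} (hu : ∀ n, ‖u n‖ ≤ C)
    (hx : ‖x‖ ≤ C) (hux : Tendsto (fun n => E.incl L (u n)) atTop (𝓝 (E.incl L x)))
    (w : Predual L hcont) :
    Tendsto (fun n => Predual.incl L hcont w (u n)) atTop
      (𝓝 (Predual.incl L hcont w x)) := by
  have hC : 0 ≤ C := (norm_nonneg _).trans hx
  refine Metric.tendsto_atTop'.2 fun ε hε => ?_
  -- Since ‖u n - x‖ ≤ 2C, replacing w by f costs at most ε / 2; C + 1 avoids dividing by zero.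
  obtain ⟨f, hf⟩ := Metric.denseRange_iff.1 (denseRange_toPredual (hcont := hcont)) w
    (ε / (4 * (C + 1))) (by positivity)
  obtain ⟨N, hN⟩ := Metric.tendsto_atTop'.1 ((f.continuous.tendsto _).comp hux) (ε / 2)
    (half_pos hε)
  refine ⟨N, fun n hn => ?_⟩
  have h1 := hN n hn
  rw [dist_eq_norm] at h1 hf ⊢
  have h2 : ‖Predual.incl L hcont (w - toPredual L hcont f) (u n - x)‖ ≤
      ε / (4 * (C + 1)) * (C + C) := by
    refine (Predual.incl L hcont (w - toPredual L hcont f)).le_of_opNorm_le_of_le ?_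
      ((norm_sub_le _ _).trans (add_le_add (hu n) hx))
    rw [LinearIsometry.norm_map]
    exact hf.le
  have h3 : ε / (4 * (C + 1)) * (C + C) ≤ ε / 2 := by
    rw [div_mul_eq_mul_div, div_le_iff₀ (by positivity)]
    nlinarith
  have h4 : Predual.incl L hcont w (u n) - Predual.incl L hcont w x =
      Predual.incl L hcont (w - toPredual L hcont f) (u n - x) +
        (f (E.incl L (u n)) - f (E.incl L x)) := by
    have h : ∀ z, Predual.incl L hcont (w - toPredual L hcont f) z =
        Predual.incl L hcont w z - f (E.incl L z) := fun z => by rw [map_sub]; rfl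
    rw [map_sub, h, h]
    ring
  rw [h4]
  refine (norm_add_le _ _).trans_lt ?_
  have h5 : ‖f (E.incl L (u n)) - f (E.incl L x)‖ < ε / 2 := h1
  linarith

end Predual

/-! ### The quotient ℓ¹(Y*) / P as the predual. -/

section Quotient

variable {L : Λ → X →L[𝕜] Y} {hcont : Continuous (E.incl L)}

lemma ellOneDual.norm_eq (y : ellOneDual 𝕜 Y) : ‖y‖ = ∑' n, ‖y n‖ := by
  rw [lp.norm_eq_tsum_rpow (by simp)]
  simp

lemma ellOneDual.norm_pairing_le (s : ℕ → Λ) (x : E L) (y : ellOneDual 𝕜 Y) :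
    ‖pairing L s x y‖ ≤ ‖y‖ * ‖x‖ := by
  rw [ellOneDual.norm_eq, ← tsum_mul_right]
  exact tsum_of_norm_bounded ((ellOneDual.summable_norm y).mul_right ‖x‖).hasSum fun n =>
    ((y n).le_opNorm _).trans
      (mul_le_mul_of_nonneg_left (x.norm_apply_le (s n)) (norm_nonneg _))

/-- The functional `x ↦ ∑ₙ yₙ(Lₙ x)` on `E`. -/
def seriesFunctional (L : Λ → X →L[𝕜] Y) (s : ℕ → Λ) (y : ellOneDual 𝕜 Y) :
    StrongDual 𝕜 (E L) :=
  LinearMap.mkContinuous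
    { toFun := fun x => pairing L s x y
      map_add' := fun x z => by
        simp only [pairing, LinearMap.coe_mk, AddHom.coe_mk, map_add]
        exact (ellOneDual.summable_pairing s x y).tsum_add (ellOneDual.summable_pairing s z y)
      map_smul' := fun c x => by
        simp only [pairing, LinearMap.coe_mk, AddHom.coe_mk, map_smul]
        exact (ellOneDual.summable_pairing s x y).tsum_const_smul c } ‖y‖
    (ellOneDual.norm_pairing_le s · y)

lemma norm_seriesFunctional_le (s : ℕ → Λ) (y : ellOneDual 𝕜 Y) :
    ‖seriesFunctional L s y‖ ≤ ‖y‖ :=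
  ContinuousLinearMap.opNorm_le_bound _ (norm_nonneg _) (ellOneDual.norm_pairing_le s · y)

/-- The functional `x ↦ ∑ₙ yₙ(Lₙ x)` on `E` as a function of `(yₙ) ∈ ℓ¹(Y*)`. -/
def synthesis (L : Λ → X →L[𝕜] Y) (s : ℕ → Λ) : ellOneDual 𝕜 Y →L[𝕜] StrongDual 𝕜 (E L) :=
  LinearMap.mkContinuous
    { toFun := seriesFunctional L s
      map_add' := fun y z => ContinuousLinearMap.ext fun x => map_add (pairing L s x) y z
      map_smul' := fun c y => ContinuousLinearMap.ext fun x => map_smul (pairing L s x) c y } 1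
    fun y => (norm_seriesFunctional_le s y).trans_eq (one_mul _).symm

lemma norm_synthesis_le (s : ℕ → Λ) (y : ellOneDual 𝕜 Y) : ‖synthesis L s y‖ ≤ ‖y‖ :=
  norm_seriesFunctional_le s y

/-- Each term comes from X*, and the series converges absolutely in E*, so its sum stays in the
closed subspace. -/
lemma synthesis_mem_predual (s : ℕ → Λ) (y : ellOneDual 𝕜 Y) :
    synthesis L s y ∈ predualSubmodule L hcont := by
  have hsum : Summable fun n => restrictDual L hcont ((y n).comp (L (s n))) :=
    Summable.of_norm_bounded (ellOneDual.summable_norm y) fun n => norm_functional_comp_le _ _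
  have heq : synthesis L s y = ∑' n, restrictDual L hcont ((y n).comp (L (s n))) := by
    ext x
    exact (hsum.hasSum.mapL (ContinuousLinearMap.apply 𝕜 𝕜 x)).tsum_eq
  rw [heq]
  exact (Submodule.isClosed_topologicalClosure _).mem_of_tendsto hsum.hasSum
    (Eventually.of_forall fun t => Submodule.sum_mem _ fun n _ => restrictDual_mem _)

/-- The synthesis map with values in the predual of `E`. -/
def synthesisPredual (hcont : Continuous (E.incl L)) (s : ℕ → Λ) :
    ellOneDual 𝕜 Y →L[𝕜] Predual L hcont :=
  (synthesis L s).codRestrict (predualSubmodule L hcont) (synthesis_mem_predual s)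

lemma synthesisPredual_apply (s : ℕ → Λ) (y : ellOneDual 𝕜 Y) (x : E L) :
    Predual.incl L hcont (synthesisPredual hcont s y) x = pairing L s x y := rfl

lemma pairing_single (s : ℕ → Λ) (x : E L) (n : ℕ) (f : StrongDual 𝕜 Y) :
    pairing L s x (lp.single 1 n f) = f (L (s n) (E.incl L x)) := by
  change ∑' m, (lp.single 1 n f : ellOneDual 𝕜 Y) m (L (s m) (E.incl L x)) = _
  rw [tsum_eq_single n fun m hm => by rw [lp.single_apply_ne _ _ _ hm]; rfl,
    lp.single_apply_self]

/-- ψ is evaluation at some x in E. Sequences with one nonzero entry recover ‖Lₙ x‖, and density of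
(Lₙ) with continuity of L ↦ L x recovers the full supremum ‖x‖. -/
lemma norm_le_norm_comp_synthesisPredual [TopologicalSpace Λ]
    (hL : ∀ x : X, Continuous fun l => L l x)
    (hrefl : Function.Surjective (NormedSpace.inclusionInDoubleDual 𝕜 X))
    {s : ℕ → Λ} (hs : DenseRange s) (ψ : StrongDual 𝕜 (Predual L hcont)) :
    ‖ψ‖ ≤ ‖ψ.comp (synthesisPredual hcont s)‖ := by
  obtain ⟨x, rfl⟩ := (evalPredualEquiv hcont hrefl).surjective ψ
  let ψ := (evalPredualEquiv hcont hrefl x).comp (synthesisPredual hcont s)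
  rw [LinearIsometryEquiv.norm_map]
  refine Real.iSup_le (fun l => ?_) (norm_nonneg ψ)
  refine hs.induction_on (p := fun l => ‖L l (E.incl L x)‖ ≤ ‖ψ‖) l
    (isClosed_le (hL _).norm continuous_const) fun n => ?_
  refine NormedSpace.norm_le_dual_bound 𝕜 _ (norm_nonneg ψ) fun f => ?_
  have h := ψ.le_opNorm
    (lp.single 1 n f)
  rwa [lp.norm_single (by simp), ContinuousLinearMap.comp_apply, evalPredualEquiv_apply,
    synthesisPredual_apply, pairing_single] at h

lemma ker_synthesisPredual (s : ℕ → Λ) :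
    LinearMap.ker (synthesisPredual hcont s).toLinearMap = P L s := by
  ext y
  simp only [P, Submodule.mem_iInf, LinearMap.mem_ker]
  constructor
  · intro h x
    exact congrArg (fun w : Predual L hcont => Predual.incl L hcont w x) h
  · intro h
    exact Subtype.ext (ContinuousLinearMap.ext h)

/-- `E_*` is isometric to the predual of `E`. -/
def quotientEquivPredual [TopologicalSpace Λ]
    (hcont : Continuous (E.incl L)) (hL : ∀ x : X, Continuous fun l => L l x)
    (hrefl : Function.Surjective (NormedSpace.inclusionInDoubleDual 𝕜 X))
    {s : ℕ → Λ} (hs : DenseRange s) : EStar L s ≃ₗᵢ[𝕜] Predual L hcont where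
  toLinearEquiv := LinearEquiv.ofBijective
    ((P L s).liftQ (synthesisPredual hcont s).toLinearMap (ker_synthesisPredual s).ge)
    ⟨LinearMap.ker_eq_bot.1 (Submodule.ker_liftQ_eq_bot _ _ _ (ker_synthesisPredual s).le),
      fun w => by
        obtain ⟨y, hy, -⟩ := exists_preimage_of_norm_le_norm_comp (synthesisPredual hcont s)
          (norm_le_norm_comp_synthesisPredual hL hrefl hs) w one_pos
        exact ⟨(P L s).mkQ y, hy⟩⟩
  norm_map' z := by
    obtain ⟨y, rfl⟩ := (P L s).mkQ_surjective z
    change ‖synthesisPredual hcont s y‖ = ‖(Submodule.Quotient.mk y : EStar L s)‖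
    refine le_antisymm (le_of_forall_pos_le_add fun ε hε => ?_)
      (le_of_forall_pos_le_add fun ε hε => ?_)
    · obtain ⟨y', hy', hlt⟩ := Submodule.Quotient.norm_mk_lt
        (Submodule.Quotient.mk y : EStar L s) hε
      have : synthesisPredual hcont s y = synthesisPredual hcont s y' := by
        have h := (Submodule.Quotient.eq (P L s)).1 hy'
        rw [← ker_synthesisPredual (hcont := hcont)] at h
        exact (sub_eq_zero.1 ((map_sub _ _ _).symm.trans h)).symm
      rw [this]
      exact (norm_synthesis_le s y').trans hlt.le
    -- Metric surjectivity supplies a representative of the same class with almost the norm of the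
    -- image.
    · obtain ⟨y', hy', hle⟩ := exists_preimage_of_norm_le_norm_comp (synthesisPredual hcont s)
        (norm_le_norm_comp_synthesisPredual hL hrefl hs) (synthesisPredual hcont s y) hε
      have : (Submodule.Quotient.mk y : EStar L s) = Submodule.Quotient.mk y' := by
        rw [Submodule.Quotient.eq, ← ker_synthesisPredual (hcont := hcont)]
        exact (map_sub _ _ _).trans (sub_eq_zero.2 hy'.symm)
      rw [this]
      exact (Submodule.Quotient.norm_mk_le _ _).trans hle

end Quotient

/-! ### The predual of E as the dual of E₀. -/

section Vanishing

open scoped ZeroAtInfty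

variable [TopologicalSpace Λ] {L : Λ → X →L[𝕜] Y} {hcont : Continuous (E.incl L)}

/-- The function `l ↦ L(l) x` in `C₀(Λ, Y)` given by `x ∈ E₀`. -/
def orbitZeroAtInfty (hL : ∀ x : X, Continuous fun l => L l x) (x : E0 L) : C₀(Λ, Y) where
  toFun l := L l (E.incl L x)
  continuous_toFun := hL _
  zero_at_infty' := tendsto_zero_iff_norm_tendsto_zero.2 x.2

/-- The embedding of `E₀` into `C₀(Λ, Y)`. -/
def embedZeroAtInfty (hL : ∀ x : X, Continuous fun l => L l x) : E0 L →ₗᵢ[𝕜] C₀(Λ, Y) where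
  toFun := orbitZeroAtInfty hL
  map_add' x y := by ext l; exact map_add (L l) _ _
  map_smul' c x := by ext l; exact map_smul (L l) _ _
  norm_map' x := by
    refine le_antisymm ((zeroAtInfty_norm_le (norm_nonneg _)).2 (E.norm_apply_le (x : E L))) ?_
    exact Real.iSup_le (fun l => zeroAtInfty_norm_apply_le (orbitZeroAtInfty hL x) l)
      (norm_nonneg _)

/-- Hahn–Banach along the isometric embedding, whose injectivity rests on ‖·‖_E being a norm. -/
lemma exists_extension_zeroAtInfty (hL : ∀ x : X, Continuous fun l => L l x)
    (hnorm : ∀ x : E L, ‖x‖ = 0 → x = 0) (φ : StrongDual 𝕜 (E0 L)) :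
    ∃ ψ : StrongDual 𝕜 C₀(Λ, Y), ∀ x, ψ (embedZeroAtInfty hL x) = φ x := by
  let V := (embedZeroAtInfty hL : E0 L →ₗᵢ[𝕜] C₀(Λ, Y))
  have hV : Function.Injective V.toLinearMap := (injective_iff_map_eq_zero _).2 fun x hx =>
    Subtype.ext (hnorm x ((V.norm_map x).symm.trans (by rw [← V.coe_toLinearMap, hx, norm_zero])))
  let e := LinearEquiv.ofInjective V.toLinearMap hV
  let φ' : StrongDual 𝕜 (LinearMap.range V.toLinearMap) :=
    LinearMap.mkContinuous (φ.toLinearMap ∘ₗ e.symm.toLinearMap) ‖φ‖ fun v => by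
      obtain ⟨x, rfl⟩ := e.surjective v
      have : ‖e x‖ = ‖x‖ := V.norm_map x
      simpa [this] using φ.le_opNorm x
  obtain ⟨ψ, hψ, -⟩ := exists_extension_norm_eq _ φ'
  exact ⟨ψ, fun x => (hψ (e x)).trans (congrArg φ (e.symm_apply_apply x))⟩

/-- If `χ` has compact support, then `x ↦ χ(l) L(l) x` is a bounded operator from `X` to
`C₀(Λ, Y)`. -/
lemma exists_cutoff_bound [CompleteSpace X] (hL : ∀ x : X, Continuous fun l => L l x)
    {χ : C(Λ, ℝ)} (hχ : HasCompactSupport χ) :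
    ∃ C, 0 ≤ C ∧ ∀ x, ‖cutoff 𝕜 χ hχ ⟨fun l => L l x, hL x⟩‖ ≤ C * ‖x‖ := by
  -- For fixed x the cut-off orbit lies in C₀(Λ, Y), so it is bounded in `l`.
  obtain ⟨C, hC⟩ := banach_steinhaus (g := fun l => (χ l : 𝕜) • L l) fun x =>
    ⟨‖cutoff 𝕜 χ hχ ⟨fun l => L l x, hL x⟩‖, fun l =>
      zeroAtInfty_norm_apply_le (cutoff 𝕜 χ hχ ⟨fun l => L l x, hL x⟩) l⟩
  refine ⟨max C 0, le_max_right _ _, fun x => ?_⟩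
  refine (zeroAtInfty_norm_le (by positivity)).2 fun l => ?_
  exact ((χ l : 𝕜) • L l).le_of_opNorm_le ((hC l).trans (le_max_left _ _)) x

/-- Restriction of functionals from the predual of `E` to `E₀`. -/
def restrictE0 (L : Λ → X →L[𝕜] Y) (hcont : Continuous (E.incl L)) :
    Predual L hcont →L[𝕜] StrongDual 𝕜 (E0 L) :=
  LinearMap.mkContinuous
    { toFun := fun w => (Predual.incl L hcont w).comp (E0 L).subtypeL
      map_add' := fun _ _ => rfl
      map_smul' := fun _ _ => rfl } 1
    fun w => ContinuousLinearMap.opNorm_le_bound _ (by positivity) fun x => by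
      rw [one_mul]
      exact (Predual.incl L hcont w).le_opNorm (x : E L)

/-- The functionals on `E₀` that are bounded on `X` are dense in `E₀*`. -/
lemma exists_norm_sub_restrict_le [CompleteSpace X] [T2Space Λ] [LocallyCompactSpace Λ]
    (hL : ∀ x : X, Continuous fun l => L l x) (hnorm : ∀ x : E L, ‖x‖ = 0 → x = 0)
    (φ : StrongDual 𝕜 (E0 L)) {ε : ℝ} (hε : 0 < ε) :
    ∃ f : StrongDual 𝕜 X, ‖φ - restrictE0 L hcont (toPredual L hcont f)‖ ≤ ε := by
  obtain ⟨ψ, hψ⟩ := exists_extension_zeroAtInfty hL hnorm φ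
  obtain ⟨χ, hχ, -, happrox⟩ := exists_cutoff_norm_sub_le ψ hε
  obtain ⟨C, hC, hCb⟩ := exists_cutoff_bound hL hχ
  let S : X →ₗ[𝕜] C₀(Λ, Y) :=
    { toFun := fun x => cutoff 𝕜 χ hχ ⟨fun l => L l x, hL x⟩
      map_add' := fun x y => by
        rw [← map_add]; congr 1; ext l; exact map_add (L l) x y
      map_smul' := fun c x => by
        rw [RingHom.id_apply, ← map_smul]; congr 1; ext l; exact map_smul (L l) c x }
  -- The cut-off orbit makes sense for every x in X, so the approximant of φ on E₀ extends to X.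
  refine ⟨ψ.comp (S.mkContinuous C hCb), ContinuousLinearMap.opNorm_le_bound _ hε.le fun x => ?_⟩
  have h := happrox (embedZeroAtInfty hL x)
  rw [hψ, LinearIsometry.norm_map] at h
  exact h

/-- Under the approximation property, restriction to `E₀` preserves the norm of the predual. -/
lemma norm_restrictE0 (hAP : ApproximationProperty L) (w : Predual L hcont) :
    ‖restrictE0 L hcont w‖ = ‖w‖ := by
  refine le_antisymm ?_ ?_
  · exact ContinuousLinearMap.opNorm_le_bound _ (norm_nonneg _) fun x =>
      (Predual.incl L hcont w).le_opNorm x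
  · refine ContinuousLinearMap.opNorm_le_bound _ (norm_nonneg _) fun x => ?_
    obtain ⟨u, hu0, hux, hu⟩ := hAP x
    refine le_of_tendsto (tendsto_predual_apply hux le_rfl hu w).norm
      (Eventually.of_forall fun n => ?_)
    exact (restrictE0 L hcont w).le_of_opNorm_le_of_le le_rfl (x := ⟨u n, hu0 n⟩) (hux n)

/-- Under the approximation property, the predual of `E` is the dual of `E₀`. -/
def predualEquivDualE0 [CompleteSpace X] [T2Space Λ] [LocallyCompactSpace Λ]
    (hcont : Continuous (E.incl L))
    (hL : ∀ x : X, Continuous fun l => L l x) (hnorm : ∀ x : E L, ‖x‖ = 0 → x = 0)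
    (hAP : ApproximationProperty L) : Predual L hcont ≃ₗᵢ[𝕜] StrongDual 𝕜 (E0 L) :=
  let R : Predual L hcont →ₗᵢ[𝕜] StrongDual 𝕜 (E0 L) :=
    ⟨(restrictE0 L hcont).toLinearMap, norm_restrictE0 hAP⟩
  LinearIsometryEquiv.ofSurjective R fun φ => by
    -- An isometric image of a complete space is closed, so density of the range suffices.
    have hclosed : IsClosed (range R) := R.isometry.isClosedEmbedding.isClosed_range
    refine hclosed.closure_subset (Metric.mem_closure_iff.2 fun ε hε => ?_)
    obtain ⟨f, hf⟩ := exists_norm_sub_restrict_le (hcont := hcont) hL hnorm φ (half_pos hε)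
    exact ⟨_, ⟨toPredual L hcont f, rfl⟩, by
      rw [dist_eq_norm]; exact hf.trans_lt (half_lt_self hε)⟩

end Vanishing

end Bidual

end

/-! ### Assembly of the three identifications. -/

theorem theorem3p2 {𝕜 X Y Λ : Type*} [RCLike 𝕜]
    [NormedAddCommGroup X] [NormedSpace 𝕜 X] [CompleteSpace X]
    [TopologicalSpace.SeparableSpace X]
    (hrefl : Function.Surjective (NormedSpace.inclusionInDoubleDual 𝕜 X))
    [NormedAddCommGroup Y] [NormedSpace 𝕜 Y] [CompleteSpace Y]
    [TopologicalSpace Λ] [T2Space Λ] [LocallyCompactSpace Λ] [SigmaCompactSpace Λ]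
    [TopologicalSpace.SeparableSpace Λ]
    (L : Λ → X →L[𝕜] Y) (hL : ∀ x : X, Continuous fun l => L l x)
    (hnorm : ∀ x : Bidual.E L, ‖x‖ = 0 → x = 0) (hcomplete : CompleteSpace (Bidual.E L))
    (hcont : Continuous (Bidual.E.incl L)) (hdense : DenseRange (Bidual.E.incl L))
    (hAP : Bidual.ApproximationProperty L)
    (s : ℕ → Λ) (hs : DenseRange s) :
    ∃ J : Bidual.E L ≃ₗᵢ[𝕜] StrongDual 𝕜 (Bidual.EStar L s),
      (∀ (x : Bidual.E L) (y : Bidual.ellOneDual 𝕜 Y),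
        J x ((Bidual.P L s).mkQ y) = ∑' n, y n (L (s n) (Bidual.E.incl L x))) ∧
      ∃ j : StrongDual 𝕜 X →L[𝕜] Bidual.EStar L s,
        Function.Injective j ∧ DenseRange j ∧
        (∀ (f : StrongDual 𝕜 X) (x : Bidual.E L), J x (j f) = f (Bidual.E.incl L x)) ∧
        ∃! K : Bidual.EStar L s ≃ₗᵢ[𝕜] StrongDual 𝕜 (Bidual.E0 L),
          ∀ (f : StrongDual 𝕜 X) (x : Bidual.E0 L), K (j f) x = f (Bidual.E.incl L x) := by
  let q := Bidual.quotientEquivPredual hcont hL hrefl hs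
  let j : StrongDual 𝕜 X →L[𝕜] Bidual.EStar L s :=
    (q.symm.toContinuousLinearEquiv : Bidual.Predual L hcont →L[𝕜] Bidual.EStar L s).comp
      (Bidual.toPredual L hcont)
  have hqj : ∀ f, q (j f) = Bidual.toPredual L hcont f := fun f => q.apply_symm_apply _
  have hjdense : DenseRange j :=
    q.symm.surjective.denseRange.comp Bidual.denseRange_toPredual q.symm.continuous
  refine ⟨(Bidual.evalPredualEquiv hcont hrefl).trans (Bidual.dualCongr q), fun x y => ?_, j,
    q.symm.injective.comp (Bidual.injective_toPredual hdense), hjdense, fun f x => ?_,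
    q.trans (Bidual.predualEquivDualE0 hcont hL hnorm hAP), fun f x => ?_, fun K hK => ?_⟩
  · rfl
  · rw [LinearIsometryEquiv.trans_apply, Bidual.dualCongr_apply, hqj]
    rfl
  · rw [LinearIsometryEquiv.trans_apply, hqj]
    rfl
  -- Uniqueness: K is continuous and prescribed on the dense range of `j`.
  · refine LinearIsometryEquiv.ext (congrFun (hjdense.equalizer K.continuous
      (LinearIsometryEquiv.continuous _) (funext fun f => ContinuousLinearMap.ext fun x => ?_)))
    rw [Function.comp_apply, Function.comp_apply, hK, LinearIsometryEquiv.trans_apply, hqj]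
    rfl
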